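/- Let $K$ be a field and let $A=\{u_1,\dots,u_n\}$ be a set of $n$ distinct monomials of the same degree $D\ge 1$ in $K[t_1,\dots,t_d]$. Let $K[A]\subseteq K[t_1,\dots,t_d]$ be the toric ring generated by $A$ over $K$, let $\mathfrak m$ be its graded maximal ideal, and let the toric ideal $I_A$ be the kernel of the $K$-algebra homomorphism $K[x_1,\dots,x_n]\to K[A]$, $x_i\mapsto u_i$. Suppose that $K[A]$ is strongly Koszul with respect to its monomial generators, i.e. $u_1,\dots,u_n$ is a minimal system of generators of $\mathfrak m$ such that for all $1\le i_1<\cdots<i_r\le n$ and all $j=1,\dots,r$ the colon ideal $(u_{i_1},\dots,u_{i_{j-1}}):u_{i_j}$ of $K[A]$ is generated by a subset of $\{u_1,\dots,u_n\}$. Then the following conditions are equivalent: (i) $K[A]$ is squarefree, i.e. it is isomorphic as a $K$-algebra to a semigroup ring generated by (finitely many) squarefree monomials in a polynomial ring over $K$; (ii) $I_A$ contains no nonzero binomial of the form $x_i^2-x_jx_k$ with $1\le i,j,k\le n$; (iii) $K[A]$ is compressed, i.e. for every ordering of the variables $x_1,\dots,x_n$ the initial ideal ${\rm in}_<(I_A)$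 with respect to the (graded) reverse lexicographic order $<$ induced by that ordering is radical: $\sqrt{{\rm in}_<(I_A)}={\rm in}_<(I_A)$. In particular, every squarefree strongly Koszul toric ring is compressed. -/

import Mathlib

open MvPolynomial

/-! ### Reverse lexicographic orders -/

/-- Exponent vectors in `n` variables, to be compared by the reverse lexicographic order with
`x_{ρ 0} < x_{ρ 1} < ⋯ < x_{ρ (n - 1)}`. -/
def RevLexSyn {n : ℕ} (_ρ : Equiv.Perm (Fin n)) : Type := Fin n →₀ ℕ

namespace RevLexSyn

variable {n : ℕ} (ρ : Equiv.Perm (Fin n))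

noncomputable instance : AddCommMonoid (RevLexSyn ρ) :=
  inferInstanceAs (AddCommMonoid (Fin n →₀ ℕ))

/-- The identity map to the synonym. -/
noncomputable def ofExp : (Fin n →₀ ℕ) ≃+ RevLexSyn ρ := AddEquiv.refl _

/-- Compare total degrees first; in case of a tie look at the smallest variable at which the two
exponents differ: the monomial with the *larger* exponent there is the *smaller* one. -/
noncomputable def key (a : RevLexSyn ρ) : ℕ ×ₗ Lex (Fin n → ℤ) :=
  toLex (Finsupp.degree ((ofExp ρ).symm a), toLex fun i => -(((ofExp ρ).symm a (ρ i) : ℕ) : ℤ))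

theorem key_injective : Function.Injective (key ρ) := by
  intro a b h
  have h2 := congrArg (fun p => ofLex (ofLex p).2) h
  apply (ofExp ρ).symm.injective
  ext i
  have := congrFun h2 (ρ.symm i)
  simpa [key] using this

theorem key_add (a b : RevLexSyn ρ) : key ρ (a + b) = key ρ a + key ρ b := by
  have h : (fun i => -(((ofExp ρ).symm (a + b) (ρ i) : ℕ) : ℤ)) =
      (fun i => -(((ofExp ρ).symm a (ρ i) : ℕ) : ℤ)) +
        fun i => -(((ofExp ρ).symm b (ρ i) : ℕ) : ℤ) := by
    funext i
    simp only [map_add, Finsupp.add_apply, Nat.cast_add, Pi.add_apply]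
    ring
  unfold key
  rw [h, map_add, map_add]
  rfl

noncomputable instance : LinearOrder (RevLexSyn ρ) := LinearOrder.lift' (key ρ) (key_injective ρ)

theorem lt_iff_key {a b : RevLexSyn ρ} : a < b ↔ key ρ a < key ρ b := Iff.rfl

theorem le_iff_key {a b : RevLexSyn ρ} : a ≤ b ↔ key ρ a ≤ key ρ b := Iff.rfl

instance : IsOrderedAddMonoid (RevLexSyn ρ) where
  add_le_add_left a b h c := by
    rw [le_iff_key] at h ⊢
    rw [key_add, key_add]
    exact add_le_add_left h _

theorem ofExp_monotone : Monotone (ofExp ρ) := by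
  intro a b h
  obtain ⟨c, rfl⟩ := exists_add_of_le h
  rcases eq_or_ne c 0 with rfl | hc
  · simp
  · apply le_of_lt
    rw [lt_iff_key, key, key, Prod.Lex.toLex_lt_toLex]
    left
    have : 0 < Finsupp.degree c := by
      rw [Nat.pos_iff_ne_zero, Ne, Finsupp.degree_eq_zero_iff]
      exact hc
    simpa using this

instance : WellFoundedLT (RevLexSyn ρ) :=
  ((ofExp_monotone ρ).wellQuasiOrderedLE_of_wellQuasiOrderedLE_of_surjective
    (ofExp ρ).surjective).to_wellFoundedLT

end RevLexSyn

/-- The (graded) reverse lexicographic order on monomials in `n` variables induced by the ordering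
`x_{ρ 0} < x_{ρ 1} < ⋯ < x_{ρ (n - 1)}` of the variables. -/
noncomputable def revLex {n : ℕ} (ρ : Equiv.Perm (Fin n)) : MonomialOrder (Fin n) where
  syn := RevLexSyn ρ
  toSyn := RevLexSyn.ofExp ρ
  toSyn_monotone := RevLexSyn.ofExp_monotone ρ

/-- The initial ideal of `I` with respect to a monomial order. -/
noncomputable def initialIdeal {σ K : Type*} [Field K] (m : MonomialOrder σ)
    (I : Ideal (MvPolynomial σ K)) : Ideal (MvPolynomial σ K) :=
  Ideal.span (m.leadingTerm '' (I : Set (MvPolynomial σ K)))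

/-! ### Toric rings and toric ideals -/

/-- The semigroup ring `K[A] ⊆ K[t_1, …, t_d]` generated by the monomials `t ^ a i`. -/
noncomputable def toricRing (K : Type*) [Field K] {n d : ℕ} (a : Fin n → Fin d →₀ ℕ) :
    Subalgebra K (MvPolynomial (Fin d) K) :=
  Algebra.adjoin K (Set.range fun i => monomial (a i) (1 : K))

/-- The generator `u_i = t ^ a i` as an element of `K[A]`. -/
noncomputable def toricGen (K : Type*) [Field K] {n d : ℕ} (a : Fin n → Fin d →₀ ℕ) (i : Fin n) :
    toricRing K a :=
  ⟨monomial (a i) 1, Algebra.subset_adjoin ⟨i, rfl⟩⟩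

/-- The toric ideal `I_A`: the kernel of `K[x_1, …, x_n] → K[A]`, `x_i ↦ u_i`. -/
noncomputable def toricIdeal (K : Type*) [Field K] {n d : ℕ} (a : Fin n → Fin d →₀ ℕ) :
    Ideal (MvPolynomial (Fin n) K) :=
  RingHom.ker (aeval (R := K) (toricGen K a))

/-- The graded maximal ideal of `K[A]`: the elements without constant term. -/
noncomputable def toricMaxIdeal (K : Type*) [Field K] {n d : ℕ} (a : Fin n → Fin d →₀ ℕ) :
    Ideal (toricRing K a) :=
  RingHom.ker ((constantCoeff (R := K) (σ := Fin d)).comp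
    (toricRing K a).val.toRingHom)

/-- `R`, with graded maximal ideal `𝔪`, is strongly Koszul with respect to the elements
`u_0, …, u_{n-1}`: they are a minimal system of generators of `𝔪`, and for all
`i_1 < ⋯ < i_r` and all `j` the colon ideal `(u_{i_1}, …, u_{i_{j-1}}) : u_{i_j}` is generated by
a subset of `{u_0, …, u_{n-1}}`. -/
structure IsStronglyKoszulWrt {R : Type*} [CommRing R] (𝔪 : Ideal R) {n : ℕ} (u : Fin n → R) :
    Prop where
  span_eq : Ideal.span (Set.range u) = 𝔪
  minimal : ∀ S : Set (Fin n), Ideal.span (u '' S) = 𝔪 → S = Set.univ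
  colon : ∀ (r : ℕ) (i : Fin r → Fin n), StrictMono i → ∀ j : Fin r,
    ∃ S : Set (Fin n),
      (Ideal.span ((fun k => u (i k)) '' {k | k < j})).colon {u (i j)} = Ideal.span (u '' S)

/-- A toric ring is strongly Koszul if it is so with respect to its monomial generators. -/
def IsStronglyKoszulToric (K : Type*) [Field K] {n d : ℕ} (a : Fin n → Fin d →₀ ℕ) : Prop :=
  IsStronglyKoszulWrt (toricMaxIdeal K a) (toricGen K a)

/-- `K[A]` is squarefree: it is isomorphic as a `K`-algebra to a semigroup ring generated by
squarefree monomials. -/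
def IsSquarefreeToric (K : Type*) [Field K] {n d : ℕ} (a : Fin n → Fin d →₀ ℕ) : Prop :=
  ∃ (p e : ℕ) (b : Fin p → Fin e →₀ ℕ), (∀ i l, b i l ≤ 1) ∧
    Nonempty (toricRing K a ≃ₐ[K] toricRing K b)

/-- `K[A]` is compressed: every reverse lexicographic initial ideal of `I_A` is radical. -/
def IsCompressedToric (K : Type*) [Field K] {n d : ℕ} (a : Fin n → Fin d →₀ ℕ) : Prop :=
  ∀ ρ : Equiv.Perm (Fin n),
    (initialIdeal (revLex ρ) (toricIdeal K a)).radical = initialIdeal (revLex ρ) (toricIdeal K a)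


/-!
In the monoid generated by the exponents `a i`, the colon conditions for pairs of generators say
that if `a i` divides `h + a j`, then some `a k` with `a k + a j = a i + a l` divides `h`. If
moreover no generator is the midpoint of two others, then which generators divide an element
depends only on the support of an expression of it. By this support criterion, for a face `F`
maximal among those avoiding a given generator, the number of generators outside `F` is the same in
all expressions of an element, and these numbers together separate elements. They are `0` or `1` on
generators, which realizes `K[A]` by squarefree monomials. By the same criterion an exponent vector
with a nonstandard multiple is itself nonstandard, so all reverse lexicographic initial ideals are
radical. Conversely, given `u_i ^ 2 = u_j * u_k` with `j ≠ i`, an order in which `x_j` is smallest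
makes `x_i ^ 2`, but not `x_i`, an initial monomial.

An isomorphism from `K[A]` onto a ring generated by squarefree monomials need not be graded. But a
generator whose image has a nonzero constant term occurs in no nontrivial quadratic relation, so it
can be translated by a constant, and all constant terms of the images can be made zero. The linear
parts `L_i` of the images are then linearly independent multilinear polynomials, and
`L_i ^ 2 = L_j * L_k` forces `L_j` to be a multiple of `L_i`, that is, `j = i`.
-/

/-! ### Families of generators in a commutative monoid -/

section Family

variable {ι M : Type*} [AddCommMonoid M] {a : ι → M}

/-- The element `∑ i, α i • a i` of the monoid generated by the family `a`, for an exponent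
vector `α`. -/
noncomputable abbrev expSum (a : ι → M) : (ι →₀ ℕ) →ₗ[ℕ] M := Finsupp.linearCombination ℕ a

theorem exponent_induction {p : (ι →₀ ℕ) → Prop} (zero : p 0)
    (add_single : ∀ i α, p α → p (α + Finsupp.single i 1)) (α : ι →₀ ℕ) : p α := by
  induction α using Finsupp.induction with
  | zero => exact zero
  | single_add i e α _ _ ih =>
    clear * - ih add_single
    induction e with
    | zero => simpa using ih
    | succ e ihe => simpa [add_right_comm] using add_single i _ ihe

theorem exists_eq_single_add_of_mem_support {α : ι →₀ ℕ} {i : ι} (hi : i ∈ α.support) :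
    ∃ γ, α = Finsupp.single i 1 + γ := by
  refine exists_add_of_le (Finsupp.single_le_iff.2 ?_)
  exact Nat.one_le_iff_ne_zero.2 (Finsupp.mem_support_iff.1 hi)

theorem exists_eq_single_add_of_degree_pos {α : ι →₀ ℕ} (hα : 0 < α.degree) :
    ∃ i γ, α = Finsupp.single i 1 + γ := by
  have h0 : α ≠ 0 := by rintro rfl; simp at hα
  obtain ⟨i, hi⟩ := Finsupp.support_nonempty_iff.2 h0
  exact ⟨i, exists_eq_single_add_of_mem_support hi⟩

theorem exists_eq_single_of_degree_eq_one {α : ι →₀ ℕ} (hα : α.degree = 1) :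
    ∃ i, α = Finsupp.single i 1 := by
  obtain ⟨i, γ, rfl⟩ := exists_eq_single_add_of_degree_pos (by omega : 0 < α.degree)
  have hγ : γ = 0 := by simpa [← Finsupp.degree_eq_zero_iff] using hα
  exact ⟨i, by rw [hγ, add_zero]⟩

/-- The generator `a i` divides `h` in the monoid generated by the family `a`. -/
def GenDvd (a : ι → M) (i : ι) (h : M) : Prop := ∃ γ, h = a i + expSum a γ

theorem GenDvd.add_expSum {i : ι} {h : M} (hi : GenDvd a i h) (γ : ι →₀ ℕ) :
    GenDvd a i (h + expSum a γ) := by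
  obtain ⟨δ, rfl⟩ := hi
  exact ⟨δ + γ, by rw [map_add, add_assoc]⟩

theorem GenDvd.mono {i : ι} {α β : ι →₀ ℕ} (hi : GenDvd a i (expSum a α)) (h : α ≤ β) :
    GenDvd a i (expSum a β) := by
  obtain ⟨γ, rfl⟩ := exists_add_of_le h
  simpa using hi.add_expSum γ

/-- All expressions of an element as a sum of generators have the same number of terms, so the
monoid generated by `a` is graded with every generator in degree one. -/
def IsHomogeneousFamily (a : ι → M) : Prop :=
  ∀ ⦃α β⦄, expSum a α = expSum a β → α.degree = β.degree

theorem IsHomogeneousFamily.not_genDvd_zero (hh : IsHomogeneousFamily a) (i : ι) :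
    ¬ GenDvd a i 0 := by
  rintro ⟨γ, hγ⟩
  have h := hh (show expSum a 0 = expSum a (Finsupp.single i 1 + γ) by simpa using hγ)
  rw [map_zero, map_add, Finsupp.degree_single] at h
  omega

/-- No generator is the midpoint of two other ones. -/
def MidpointFree (a : ι → M) : Prop := ∀ ⦃i j k⦄, a i + a i = a j + a k → j = i

/-- In the monoid `H` generated by `a`, the colon ideal `(a i + H) : a j` is generated by
generators `a k`. -/
def IsColonGenerated (a : ι → M) (i j : ι) : Prop :=
  ∀ ⦃α⦄, GenDvd a i (expSum a α + a j) →
    ∃ k l, GenDvd a k (expSum a α) ∧ a k + a j = a i + a l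

theorem IsColonGenerated.symm [IsCancelAdd M] {i j : ι} (h : IsColonGenerated a i j) :
    IsColonGenerated a j i := by
  rintro α ⟨β, hβ⟩
  obtain ⟨k, l, ⟨γ, hγ⟩, hkl⟩ := h (α := β) ⟨α, by rw [add_comm, ← hβ, add_comm]⟩
  refine ⟨l, k, ⟨γ, add_right_cancel (b := a i) ?_⟩, by rw [add_comm, ← hkl, add_comm]⟩
  calc expSum a α + a i = a k + a j + expSum a γ := by rw [hβ, hγ]; abel
    _ = a l + expSum a γ + a i := by rw [hkl]; abel

/-- A set of generators containing every generator that divides a sum of its elements. -/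
def IsGenFace (a : ι → M) (F : Set ι) : Prop :=
  ∀ ⦃α i⦄, α ∈ Finsupp.supported ℕ ℕ F → GenDvd a i (expSum a α) → i ∈ F

/-- The smallest face containing `T`. -/
def genClosure (a : ι → M) (T : Set ι) : Set ι :=
  {i | ∃ α ∈ Finsupp.supported ℕ ℕ T, GenDvd a i (expSum a α)}

theorem subset_genClosure (a : ι → M) (T : Set ι) : T ⊆ genClosure a T := fun i hi =>
  ⟨Finsupp.single i 1, Finsupp.single_mem_supported ℕ 1 hi, 0, by simp⟩

theorem exists_expSum_eq_add_of_mem_supported_genClosure {T : Set ι} {α : ι →₀ ℕ}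
    (hα : α ∈ Finsupp.supported ℕ ℕ (genClosure a T)) :
    ∃ β ∈ Finsupp.supported ℕ ℕ T, ∃ γ, expSum a β = expSum a α + expSum a γ := by
  induction α using exponent_induction with
  | zero => exact ⟨0, zero_mem _, 0, by simp⟩
  | add_single i α ih =>
    rw [Finsupp.mem_supported] at hα
    obtain ⟨β, hβ, γ, h⟩ := ih <| (Finsupp.mem_supported _ _).2 <|
      (Finset.coe_subset.2 (Finsupp.support_mono le_self_add)).trans hα
    obtain ⟨β', hβ', γ', h'⟩ := hα (show i ∈ _ by simp)
    refine ⟨β + β', add_mem hβ hβ', γ + γ', ?_⟩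
    simp only [map_add, h, h', Finsupp.linearCombination_single]
    module

theorem isGenFace_genClosure (a : ι → M) (T : Set ι) : IsGenFace a (genClosure a T) := by
  intro α i hα hi
  obtain ⟨β, hβ, γ, h⟩ := exists_expSum_eq_add_of_mem_supported_genClosure hα
  exact ⟨β, hβ, h ▸ hi.add_expSum γ⟩

end Family

/-! ### Midpoint-free configurations with quadratic colon ideals -/

section MidpointFree

variable {ι M : Type*} [AddCommMonoid M] {a : ι → M}
  (hh : IsHomogeneousFamily a) (hc : ∀ i j, i ≠ j → IsColonGenerated a i j)
  (hm : MidpointFree a)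

include hh hc hm

theorem eq_of_genDvd_nsmul {j p : ι} {e : ℕ} (h : GenDvd a j (e • a p)) : j = p := by
  induction e generalizing j with
  | zero => exact absurd (by simpa using h) (hh.not_genDvd_zero j)
  | succ e ih =>
    by_contra hj
    obtain ⟨k, l, hk, hkl⟩ := hc j p hj (α := Finsupp.single p e) (by simpa [add_smul] using h)
    obtain rfl := ih (by simpa using hk)
    exact hj (hm hkl)

theorem genDvd_add_of_genDvd_add_nsmul {j p : ι} {e : ℕ} {α : ι →₀ ℕ}
    (h : GenDvd a j (expSum a α + e • a p)) : GenDvd a j (expSum a α + a p) := by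
  induction α using exponent_induction generalizing j with
  | zero =>
    obtain rfl := eq_of_genDvd_nsmul hh hc hm (by simpa using h)
    exact ⟨0, by simp⟩
  | add_single q α ih =>
    by_cases hj : j = q
    · subst hj
      exact ⟨α + Finsupp.single p 1, by simp; abel⟩
    · obtain ⟨k, l, hk, hkl⟩ := hc j q hj (α := α + Finsupp.single p e)
        (by simpa [add_right_comm] using h)
      obtain ⟨γ, hγ⟩ := ih (by simpa using hk)
      refine ⟨Finsupp.single l 1 + γ, ?_⟩
      calc expSum a (α + Finsupp.single q 1) + a p = expSum a α + a p + a q := by simp; abel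
        _ = a k + a q + expSum a γ := by rw [hγ]; abel
        _ = a j + expSum a (Finsupp.single l 1 + γ) := by rw [hkl]; simp [add_assoc]

theorem genDvd_of_support_subset {j : ι} {α β : ι →₀ ℕ} (h : GenDvd a j (expSum a α))
    (hs : α.support ⊆ β.support) : GenDvd a j (expSum a β) := by
  replace h : GenDvd a j (expSum a (α + β)) := h.mono le_self_add
  induction α using exponent_induction with
  | zero => rwa [zero_add] at h
  | add_single i α ih =>
    obtain ⟨γ, hγ⟩ := exists_eq_single_add_of_mem_support (hs (by simp) : i ∈ β.support)
    refine ih ((Finsupp.support_mono le_self_add).trans hs) ?_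
    have hd : GenDvd a j (expSum a (α + γ) + 2 • a i) := by
      convert h using 1
      simp only [hγ, map_add, Finsupp.linearCombination_single]
      module
    convert genDvd_add_of_genDvd_add_nsmul hh hc hm hd using 1
    simp only [hγ, map_add, Finsupp.linearCombination_single]
    module

end MidpointFree

/-! ### Heights over maximal faces -/

section MaximalFace

variable {ι M : Type*} [AddCommMonoid M] {a : ι → M}

theorem IsGenFace.le_of_add_nsmul_eq [IsCancelAdd M] {F : Set ι} (hF : IsGenFace a F) {i : ι}
    (hi : i ∉ F) {f γ : ι →₀ ℕ} (hf : f ∈ Finsupp.supported ℕ ℕ F) {e e' : ℕ}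
    (h : expSum a f + e • a i = expSum a γ + e' • a i) : e' ≤ e := by
  by_contra! he
  obtain ⟨m, rfl⟩ := Nat.exists_eq_add_of_lt he
  refine hi (hF hf ⟨γ + Finsupp.single i m, add_right_cancel (b := e • a i) ?_⟩)
  rw [h, map_add, Finsupp.linearCombination_single]
  module

/-- `F` is maximal among the faces that do not contain `i`. -/
def IsMaximalFace (a : ι → M) (i : ι) (F : Set ι) : Prop :=
  Maximal (fun G => IsGenFace a G ∧ i ∉ G) F

theorem exists_isMaximalFace_ge [Finite ι] {i : ι} {G : Set ι} (hG : IsGenFace a G)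
    (hi : i ∉ G) : ∃ F, G ⊆ F ∧ IsMaximalFace a i F :=
  (Set.toFinite {G | IsGenFace a G ∧ i ∉ G}).exists_le_maximal ⟨hG, hi⟩

/-- The number of generators outside `F`, with multiplicity, in an expression `α`. The heights over
the maximal faces are the exponents in a realization by squarefree monomials. -/
noncomputable abbrev faceHeight (F : Set ι) : (ι →₀ ℕ) →ₗ[ℕ] ℕ := expSum (Set.indicator Fᶜ 1)

theorem faceHeight_eq_zero_iff {F : Set ι} {α : ι →₀ ℕ} :
    faceHeight F α = 0 ↔ α ∈ Finsupp.supported ℕ ℕ F := by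
  rw [Finsupp.linearCombination_apply, Finsupp.sum, Finset.sum_eq_zero_iff,
    Finsupp.mem_supported]
  refine forall₂_congr fun i hi => ?_
  by_cases h : i ∈ F
  · simp [h]
  · simpa [h] using hi

variable (hh : IsHomogeneousFamily a) (hc : ∀ i j, i ≠ j → IsColonGenerated a i j)
  (hm : MidpointFree a)

section

variable {F : Set ι} {i : ι} (hF : IsMaximalFace a i F)

include hh hc hm hF

theorem exists_add_eq_add_of_notMem {k : ι} (hk : k ∉ F) :
    ∃ f ∈ Finsupp.supported ℕ ℕ F, ∃ γ, a k + expSum a f = a i + expSum a γ := by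
  classical
  have hi : i ∈ genClosure a (insert k F) := by
    by_contra hi
    have hle := hF.le_of_ge ⟨isGenFace_genClosure a _, hi⟩
      ((Set.subset_insert k F).trans (subset_genClosure a _))
    exact hk (hle (subset_genClosure a _ (Set.mem_insert k F)))
  obtain ⟨α, hα, hd⟩ := hi
  have hs : α.support ⊆ (Finsupp.single k 1 + α.erase k).support := by
    intro l hl
    by_cases hlk : l = k
    · simp [hlk]
    · simpa [hlk] using hl
  obtain ⟨γ, hγ⟩ := genDvd_of_support_subset hh hc hm hd hs
  refine ⟨α.erase k, (Finsupp.mem_supported ℕ _).2 fun l hl => ?_, γ, by simpa using hγ⟩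
  rw [Finsupp.support_erase, Finset.coe_erase] at hl
  exact (hα hl.1).resolve_left hl.2

theorem add_ne_two_nsmul_add [IsCancelAdd M] {j : ι} {f γ : ι →₀ ℕ}
    (hf : f ∈ Finsupp.supported ℕ ℕ F) :
    a j + expSum a f ≠ expSum a γ + 2 • a i := by
  intro h
  obtain ⟨δ, hδ⟩ := genDvd_add_of_genDvd_add_nsmul hh hc hm ⟨f, h.symm⟩
  refine hF.prop.2 (hF.prop.1 hf ⟨δ, add_left_cancel (a := a j) ?_⟩)
  calc a j + expSum a f = (expSum a γ + a i) + a i := by rw [h]; module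
    _ = a j + (a i + expSum a δ) := by rw [hδ]; abel

theorem exists_mem_supported_add_eq_add [IsCancelAdd M] {j : ι} (hj : j ∉ F) :
    ∃ f ∈ Finsupp.supported ℕ ℕ F, ∃ g ∈ Finsupp.supported ℕ ℕ F,
      a j + expSum a f = a i + expSum a g := by
  obtain ⟨f, hf, γ, h⟩ := exists_add_eq_add_of_notMem hh hc hm hF hj
  refine ⟨f, hf, γ, (Finsupp.mem_supported ℕ γ).2 fun k hk => ?_, h⟩
  by_contra hkF
  obtain ⟨δ, rfl⟩ := exists_eq_single_add_of_mem_support hk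
  obtain ⟨f', hf', γ', h'⟩ := exists_add_eq_add_of_notMem hh hc hm hF hkF
  refine add_ne_two_nsmul_add hh hc hm hF (j := j) (γ := γ' + δ) (add_mem hf hf') ?_
  calc a j + expSum a (f + f') = a j + expSum a f + expSum a f' := by simp [add_assoc]
    _ = a i + (a k + expSum a f') + expSum a δ := by rw [h]; simp; abel
    _ = expSum a (γ' + δ) + 2 • a i := by rw [h', map_add]; module

theorem exists_expSum_add_eq_faceHeight_nsmul_add [IsCancelAdd M] (α : ι →₀ ℕ) :
    ∃ f ∈ Finsupp.supported ℕ ℕ F, ∃ g ∈ Finsupp.supported ℕ ℕ F,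
      expSum a α + expSum a f = expSum a g + faceHeight F α • a i := by
  induction α using exponent_induction with
  | zero => exact ⟨0, zero_mem _, 0, zero_mem _, by simp⟩
  | add_single j α ih =>
    obtain ⟨f, hf, g, hg, h⟩ := ih
    by_cases hj : j ∈ F
    · refine ⟨f, hf, g + Finsupp.single j 1,
        add_mem hg (Finsupp.single_mem_supported ℕ 1 hj), ?_⟩
      simpa [hj, add_right_comm] using congrArg (· + a j) h
    · obtain ⟨f', hf', g', hg', h'⟩ := exists_mem_supported_add_eq_add hh hc hm hF hj
      refine ⟨f + f', add_mem hf hf', g + g', add_mem hg hg', ?_⟩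
      calc expSum a (α + Finsupp.single j 1) + expSum a (f + f')
          = (expSum a α + expSum a f) + (a j + expSum a f') := by simp; abel
        _ = expSum a (g + g') + (faceHeight F α + 1) • a i := by rw [h, h', map_add]; module
        _ = _ := by simp [hj]

theorem faceHeight_congr [IsCancelAdd M] {α β : ι →₀ ℕ} (h : expSum a α = expSum a β) :
    faceHeight F α = faceHeight F β := by
  have hle : ∀ {α β : ι →₀ ℕ}, expSum a α = expSum a β → faceHeight F α ≤ faceHeight F β := by
    intro α β h
    obtain ⟨f, hf, g, -, h₁⟩ := exists_expSum_add_eq_faceHeight_nsmul_add hh hc hm hF α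
    obtain ⟨f', -, g', hg', h₂⟩ := exists_expSum_add_eq_faceHeight_nsmul_add hh hc hm hF β
    refine hF.prop.1.le_of_add_nsmul_eq hF.prop.2 (γ := g + f') (add_mem hg' hf) ?_
    calc expSum a (g' + f) + faceHeight F β • a i
        = (expSum a g' + faceHeight F β • a i) + expSum a f := by rw [map_add]; abel
      _ = (expSum a α + expSum a f) + expSum a f' := by rw [← h₂, h]; abel
      _ = expSum a (g + f') + faceHeight F α • a i := by rw [h₁, map_add]; abel
  exact (hle h).antisymm (hle h.symm)

end

include hh hc hm

theorem genDvd_of_faceHeight_eq [Finite ι] {α β : ι →₀ ℕ}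
    (h : ∀ i F, IsMaximalFace a i F → faceHeight F α = faceHeight F β) {i : ι}
    (hi : i ∈ β.support) : GenDvd a i (expSum a α) := by
  have hcl : i ∈ genClosure a α.support := by
    by_contra hcl
    obtain ⟨F, hle, hF⟩ := exists_isMaximalFace_ge (isGenFace_genClosure a _) hcl
    have hα : α ∈ Finsupp.supported ℕ ℕ F := (subset_genClosure a _).trans hle
    rw [← faceHeight_eq_zero_iff, h i F hF, faceHeight_eq_zero_iff] at hα
    exact hF.prop.2 (hα hi)
  obtain ⟨γ, hγ, hd⟩ := hcl
  exact genDvd_of_support_subset hh hc hm hd (Finset.coe_subset.1 hγ)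

theorem expSum_eq_of_faceHeight_eq [IsCancelAdd M] [Finite ι] {α β : ι →₀ ℕ}
    (h : ∀ i F, IsMaximalFace a i F → faceHeight F α = faceHeight F β) :
    expSum a α = expSum a β := by
  induction β using exponent_induction generalizing α with
  | zero =>
    have hα : α = 0 := by
      rw [← Finsupp.support_eq_empty, Finset.eq_empty_iff_forall_notMem]
      intro i hi
      have hd := genDvd_of_faceHeight_eq hh hc hm (fun i F hF => (h i F hF).symm) hi
      exact hh.not_genDvd_zero i (by rwa [map_zero] at hd)
    rw [hα]
  | add_single i β ih =>
    obtain ⟨γ, hγ⟩ := genDvd_of_faceHeight_eq hh hc hm h (i := i) (by simp)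
    have hα : expSum a α = expSum a (γ + Finsupp.single i 1) := by simp [hγ, add_comm]
    rw [hα, map_add, map_add, ih]
    intro k F hF
    have hF' := (faceHeight_congr hh hc hm hF hα).symm.trans (h k F hF)
    rw [map_add, map_add] at hF'
    exact Nat.add_right_cancel hF'

end MaximalFace

/-! ### Minimal families -/

section MinimalFamily

variable {ι M : Type*} [AddCommMonoid M] {a : ι → M}

/-- Every generator is expressed as a sum of generators only by itself. -/
def IsMinimalFamily (a : ι → M) : Prop := ∀ ⦃i α⦄, expSum a α = a i → α = Finsupp.single i 1

theorem IsMinimalFamily.injective (ha : IsMinimalFamily a) : Function.Injective a := fun i j h =>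
  Finsupp.single_left_injective one_ne_zero (ha (i := j) (by simpa using h))

theorem IsMinimalFamily.eq_or_two_le_degree (ha : IsMinimalFamily a) {α β : ι →₀ ℕ}
    (h : expSum a α = expSum a β) : α = β ∨ 2 ≤ α.degree ∧ 2 ≤ β.degree := by
  have hsmall : ∀ {α β : ι →₀ ℕ}, expSum a α = expSum a β → α.degree < 2 → β = α := by
    intro α β h hα
    obtain hα | hα : α.degree = 0 ∨ α.degree = 1 := by omega
    · obtain rfl := (Finsupp.degree_eq_zero_iff α).1 hα
      by_contra hβ
      obtain ⟨i, -⟩ := Finsupp.support_nonempty_iff.2 hβ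
      exact hβ (add_eq_left.1 (ha (i := i) (by simp [← h] : expSum a (_ + β) = a i)))
    · obtain ⟨i, rfl⟩ := exists_eq_single_of_degree_eq_one hα
      exact ha (by simpa using h.symm)
  by_contra! hc
  by_cases hα : α.degree < 2
  · exact hc.1 (hsmall h hα).symm
  · exact hc.1 (hsmall h.symm (hc.2 (by omega)))

theorem IsHomogeneousFamily.isMinimalFamily (hh : IsHomogeneousFamily a)
    (ha : Function.Injective a) : IsMinimalFamily a := by
  intro i α h
  obtain ⟨j, rfl⟩ := exists_eq_single_of_degree_eq_one
    (by simpa using hh (h.trans (by simp : a i = expSum a (Finsupp.single i 1))))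
  rw [ha (by simpa using h : a j = a i)]

theorem isHomogeneousFamily_of_map_eq (deg : M →+ ℕ) {D : ℕ} (hD : 0 < D)
    (hdeg : ∀ i, deg (a i) = D) : IsHomogeneousFamily a := by
  have h : ∀ α : ι →₀ ℕ, deg (expSum a α) = α.degree * D := by
    intro α
    induction α using exponent_induction with
    | zero => simp
    | add_single i α ih => simp [ih, hdeg, add_mul]
  intro α β hαβ
  exact Nat.eq_of_mul_eq_mul_right hD (by rw [← h, ← h, hαβ])

theorem isMinimalFamily_of_addIrreducible (ha : Function.Injective a)
    (hirr : ∀ i, AddIrreducible (a i)) : IsMinimalFamily a := by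
  intro i α h
  have hα : α ≠ 0 := by
    rintro rfl
    exact (hirr i).ne_zero (by simpa using h.symm)
  obtain ⟨j, hj⟩ := Finsupp.support_nonempty_iff.2 hα
  obtain ⟨γ, rfl⟩ := exists_eq_single_add_of_mem_support hj
  have h : a i = a j + expSum a γ := by simpa using h.symm
  have hγ : γ = 0 := by
    by_contra hγ
    obtain ⟨k, hk⟩ := Finsupp.support_nonempty_iff.2 hγ
    obtain ⟨δ, rfl⟩ := exists_eq_single_add_of_mem_support hk
    have hu := ((hirr i).isAddUnit_or_isAddUnit h).resolve_left (hirr j).not_isAddUnit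
    refine (hirr k).not_isAddUnit (isAddUnit_of_add_isAddUnit_left ?_ (y := expSum a δ))
    simpa using hu
  subst hγ
  rw [ha (by simpa using h : a i = a j), add_zero]

theorem exists_isMinimalFamily_of_closure_eq_top {M : Type*} [AddCancelCommMonoid M]
    [Subsingleton (AddUnits M)] [Finite ι] {a : ι → M}
    (ha : AddSubmonoid.closure (Set.range a) = ⊤) : ∃ (p : ℕ) (b : Fin p → M),
      IsMinimalFamily b ∧ Set.range b ⊆ Set.range a ∧ AddSubmonoid.closure (Set.range b) = ⊤ := by
  have : AddMonoid.FG M := AddMonoid.fg_iff.2 ⟨Set.range a, ha, Set.finite_range a⟩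
  have : Finite {x : M | AddIrreducible x} := finite_addIrreducible
  obtain ⟨p, ⟨e⟩⟩ := Finite.exists_equiv_fin {x : M | AddIrreducible x}
  have hrange : Set.range (fun l => (e.symm l : M)) = {x | AddIrreducible x} :=
    (e.symm.surjective.range_comp Subtype.val).trans Subtype.range_coe
  refine ⟨p, fun l => e.symm l, isMinimalFamily_of_addIrreducible
    (Subtype.val_injective.comp e.symm.injective) fun l => (e.symm l).2, ?_, ?_⟩
  · rw [hrange]
    exact addIrreducible_subset_of_addSubmonoidClosure_eq_top ha
  · rw [hrange]
    exact AddSubmonoid.closure_addIrreducible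

theorem exists_isMinimalFamily [IsCancelAdd M] [Subsingleton (AddUnits M)] [Finite ι]
    (a : ι → M) : ∃ (p : ℕ) (b : Fin p → M), IsMinimalFamily b ∧
      Set.range b ⊆ Set.range a ∧ ∀ i, ∃ α, a i = expSum b α := by
  let S := AddSubmonoid.closure (Set.range a)
  have : Subsingleton (AddUnits S) :=
    (AddUnits.map_injective (f := S.subtype) Subtype.val_injective).subsingleton
  let _ : AddCancelCommMonoid S :=
    { (inferInstance : AddCommMonoid S) with
      add_left_cancel := fun _ _ _ h => Subtype.ext (add_left_cancel (congrArg Subtype.val h)) }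
  let a' : ι → S := fun i => ⟨a i, AddSubmonoid.subset_closure ⟨i, rfl⟩⟩
  have ha' : AddSubmonoid.closure (Set.range a') = ⊤ := by
    convert AddSubmonoid.closure_closure_coe_preimage (s := Set.range a)
    ext x
    simp [a', Subtype.ext_iff]
  obtain ⟨p, b, hb, hba, htop⟩ := exists_isMinimalFamily_of_closure_eq_top (M := S) ha'
  have hcoe : ∀ α, expSum (fun l => (b l : M)) α = (expSum b α : S) := fun α =>
    (Finsupp.apply_linearCombination ℕ S.subtype.toNatLinearMap b α).symm
  refine ⟨p, fun l => b l, fun l α h => hb (Subtype.ext ((hcoe α).symm.trans h)), ?_, fun i => ?_⟩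
  · rintro _ ⟨l, rfl⟩
    obtain ⟨i, hi⟩ := hba ⟨l, rfl⟩
    exact ⟨i, congrArg Subtype.val hi⟩
  · obtain ⟨α, hα⟩ := AddSubmonoid.mem_closure_range_iff.1 (htop ▸ AddSubmonoid.mem_top (a' i))
    exact ⟨α, (congrArg Subtype.val hα).trans (hcoe α).symm⟩

end MinimalFamily

/-! ### Toric rings -/

section ToricRing

variable {K : Type*} [Field K] {n d : ℕ} {a : Fin n → Fin d →₀ ℕ}

/-- The monomial with exponent `expSum a α`, as an element of the toric ring. -/
noncomputable def toricMon (K : Type*) [Field K] {n d : ℕ} (a : Fin n → Fin d →₀ ℕ)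
    (α : Fin n →₀ ℕ) : toricRing K a :=
  aeval (toricGen K a) (monomial α (1 : K))

@[simp]
theorem coe_toricMon (α : Fin n →₀ ℕ) :
    (toricMon K a α : MvPolynomial (Fin d) K) = monomial (expSum a α) 1 := by
  induction α using exponent_induction with
  | zero => simp [toricMon]
  | add_single i α ih =>
    have h : toricMon K a (α + Finsupp.single i 1) = toricMon K a α * toricGen K a i := by
      rw [toricMon, ← mul_one (1 : K), ← monomial_mul, map_mul, ← X, aeval_X, toricMon]
    simp [h, ih, toricGen, monomial_mul]

theorem toricMon_add (α β : Fin n →₀ ℕ) :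
    toricMon K a (α + β) = toricMon K a α * toricMon K a β := by
  apply Subtype.ext
  simp [monomial_mul]

theorem toricMon_single (i : Fin n) : toricMon K a (Finsupp.single i 1) = toricGen K a i :=
  aeval_X _ _

theorem toricMon_inj {α β : Fin n →₀ ℕ} :
    toricMon K a α = toricMon K a β ↔ expSum a α = expSum a β := by
  rw [Subtype.ext_iff, coe_toricMon, coe_toricMon]
  exact (monomial_left_injective one_ne_zero).eq_iff

theorem aeval_toricGen_surjective : Function.Surjective (aeval (R := K) (toricGen K a)) := by
  rintro ⟨x, hx⟩
  have hx' := hx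
  rw [toricRing, Algebra.adjoin_range_eq_range_aeval] at hx'
  obtain ⟨f, rfl⟩ := hx'
  exact ⟨f, Subtype.ext (comp_aeval_apply (toricGen K a) (toricRing K a).val f)⟩

theorem toricRing_induction {p : toricRing K a → Prop}
    (algebraMap : ∀ c : K, p (algebraMap K _ c)) (add : ∀ x y, p x → p y → p (x + y))
    (mul_toricGen : ∀ x i, p x → p (x * toricGen K a i)) (x : toricRing K a) : p x := by
  obtain ⟨f, rfl⟩ := aeval_toricGen_surjective x
  induction f using MvPolynomial.induction_on with
  | C c => rw [aeval_C]; exact algebraMap c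
  | add f g hf hg => rw [map_add]; exact add _ _ hf hg
  | mul_X f i hf => rw [map_mul, aeval_X]; exact mul_toricGen _ i hf

theorem toricRing_algHom_ext {T : Type*} [CommSemiring T] [Algebra K T]
    {φ ψ : toricRing K a →ₐ[K] T} (h : ∀ i, φ (toricGen K a i) = ψ (toricGen K a i)) : φ = ψ := by
  have hcomp : φ.comp (aeval (toricGen K a)) = ψ.comp (aeval (toricGen K a)) := by
    ext i
    simp [h]
  exact (AlgHom.cancel_right aeval_toricGen_surjective).1 hcomp

section Lift

variable {T : Type*} [CommRing T] [Algebra K T] (t : Fin n → T)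
  (ht : Function.FactorsThrough (fun α => aeval t (monomial α (1 : K))) (expSum a))

include ht in
theorem toricIdeal_le_ker_aeval : toricIdeal K a ≤ RingHom.ker (aeval (R := K) t) := by
  let Λ : toricRing K a →ₗ[K] T := (basisMonomials (Fin d) K).constr K
    (Function.extend (expSum a) (fun α => aeval t (monomial α (1 : K))) 0) ∘ₗ
      (toricRing K a).val.toLinearMap
  have hΛ : ∀ α, Λ (toricMon K a α) = aeval t (monomial α (1 : K)) := by
    intro α
    rw [LinearMap.comp_apply, AlgHom.toLinearMap_apply, Subalgebra.coe_val, coe_toricMon]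
    exact ((basisMonomials (Fin d) K).constr_basis K _ (expSum a α)).trans (ht.extend_apply 0 α)
  have hcomp : Λ ∘ₗ (aeval (toricGen K a)).toLinearMap = (aeval (R := K) t).toLinearMap :=
    linearMap_ext fun α => LinearMap.ext_ring (hΛ α)
  intro f hf
  rw [toricIdeal, RingHom.mem_ker] at hf
  have h := DFunLike.congr_fun hcomp f
  rwa [LinearMap.comp_apply, AlgHom.toLinearMap_apply, hf, map_zero, eq_comm] at h

/-- The homomorphism out of a toric ring that sends the `i`-th generator to `t i`. -/
noncomputable def toricLift : toricRing K a →ₐ[K] T :=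
  AlgHom.liftOfSurjective _ aeval_toricGen_surjective (aeval t) (toricIdeal_le_ker_aeval t ht)

theorem toricLift_toricGen (i : Fin n) : toricLift t ht (toricGen K a i) = t i := by
  have h := AlgHom.liftOfSurjective_apply _ (aeval_toricGen_surjective (K := K) (a := a)) (aeval t)
    (toricIdeal_le_ker_aeval t ht) (X i)
  rwa [aeval_X, aeval_X] at h

end Lift

theorem nonempty_toricRing_algEquiv {e : ℕ} {b : Fin n → Fin e →₀ ℕ}
    (h : ∀ α β : Fin n →₀ ℕ, expSum a α = expSum a β ↔ expSum b α = expSum b β) :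
    Nonempty (toricRing K a ≃ₐ[K] toricRing K b) := by
  let φ : toricRing K a →ₐ[K] toricRing K b :=
    toricLift (toricGen K b) fun α β hαβ => toricMon_inj.2 ((h α β).1 hαβ)
  let ψ : toricRing K b →ₐ[K] toricRing K a :=
    toricLift (toricGen K a) fun α β hαβ => toricMon_inj.2 ((h α β).2 hαβ)
  have hφ : ∀ i, φ (toricGen K a i) = toricGen K b i := toricLift_toricGen _ _
  have hψ : ∀ i, ψ (toricGen K b i) = toricGen K a i := toricLift_toricGen _ _
  exact ⟨AlgEquiv.ofAlgHom φ ψ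
    (toricRing_algHom_ext fun i => (congrArg φ (hψ i)).trans (hφ i))
    (toricRing_algHom_ext fun i => (congrArg ψ (hφ i)).trans (hψ i))⟩

theorem monomial_sub_monomial_mem_toricIdeal {α β : Fin n →₀ ℕ} :
    (monomial α 1 - monomial β 1 : MvPolynomial (Fin n) K) ∈ toricIdeal K a ↔
      expSum a α = expSum a β := by
  rw [toricIdeal, RingHom.mem_ker, map_sub, sub_eq_zero]
  exact toricMon_inj

theorem sq_sub_mul_mem_toricIdeal {i j k : Fin n} :
    (X i ^ 2 - X j * X k : MvPolynomial (Fin n) K) ∈ toricIdeal K a ↔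
      a i + a i = a j + a k := by
  have hX : (X i ^ 2 - X j * X k : MvPolynomial (Fin n) K) =
      monomial (Finsupp.single i 1 + Finsupp.single i 1) 1 -
        monomial (Finsupp.single j 1 + Finsupp.single k 1) 1 := by
    rw [sq, X, X, X, monomial_mul, monomial_mul, mul_one]
  rw [hX, monomial_sub_monomial_mem_toricIdeal]
  simp

theorem not_exists_sq_sub_mul_mem_toricIdeal_iff (ha : Function.Injective a) :
    (¬ ∃ i j k : Fin n, (X i ^ 2 - X j * X k : MvPolynomial (Fin n) K) ≠ 0 ∧
      (X i ^ 2 - X j * X k : MvPolynomial (Fin n) K) ∈ toricIdeal K a) ↔ MidpointFree a := by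
  push Not
  refine forall₃_congr fun i j k => ?_
  rw [sq_sub_mul_mem_toricIdeal]
  constructor
  · intro h he
    by_contra hj
    refine h (fun h0 => hj ?_) he
    have hdvd : (X j : MvPolynomial (Fin n) K) ∣ X i ^ 2 := ⟨X k, sub_eq_zero.1 h0⟩
    exact X_dvd_X.1 ((X_prime (i := j)).dvd_of_dvd_pow hdvd)
  · intro h h0 he
    obtain rfl := h he
    obtain rfl := ha (add_left_cancel he)
    exact h0 (by ring)

theorem exists_eq_expSum_of_coeff_ne_zero (x : toricRing K a) {s : Fin d →₀ ℕ}
    (hs : coeff s (x : MvPolynomial (Fin d) K) ≠ 0) : ∃ α, s = expSum a α := by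
  induction x using toricRing_induction generalizing s with
  | algebraMap c =>
    refine ⟨0, ?_⟩
    by_contra h0
    rw [map_zero] at h0
    exact hs ((coeff_C s c).trans (if_neg (Ne.symm h0)))
  | add x y hx hy =>
    by_cases h : coeff s (x : MvPolynomial (Fin d) K) = 0
    · exact hy (by simpa [h] using hs)
    · exact hx h
  | mul_toricGen x i hx =>
    have hi : coeff s (x * toricGen K a i : MvPolynomial (Fin d) K) =
        if a i ≤ s then coeff (s - a i) (x : MvPolynomial (Fin d) K) * 1 else 0 :=
      coeff_mul_monomial' s (a i) 1 _
    rw [MulMemClass.coe_mul, hi, mul_one] at hs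
    obtain ⟨hle, hx'⟩ := ite_ne_right_iff.1 hs
    obtain ⟨α, hα⟩ := hx hx'
    exact ⟨α + Finsupp.single i 1, by simp [← hα, tsub_add_cancel_of_le hle]⟩

theorem exists_genDvd_of_mem_span {S : Set (Fin n)} {x : toricRing K a}
    (hx : x ∈ Ideal.span (toricGen K a '' S)) {s : Fin d →₀ ℕ}
    (hs : coeff s (x : MvPolynomial (Fin d) K) ≠ 0) : ∃ k ∈ S, GenDvd a k s := by
  induction hx using Submodule.span_induction generalizing s with
  | mem x h =>
    obtain ⟨k, hk, rfl⟩ := h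
    refine ⟨k, hk, 0, ?_⟩
    by_contra hks
    simp only [map_zero, add_zero] at hks
    simp [toricGen, coeff_monomial, Ne.symm hks] at hs
  | zero => simp at hs
  | add x y _ _ hx hy =>
    by_cases h : coeff s (x : MvPolynomial (Fin d) K) = 0
    · exact hy (by simpa [h] using hs)
    · exact hx h
  | smul r x _ hx =>
    rw [smul_eq_mul, MulMemClass.coe_mul, coeff_mul] at hs
    obtain ⟨⟨p, q⟩, hpq, h⟩ := Finset.exists_ne_zero_of_sum_ne_zero hs
    obtain rfl := Finset.HasAntidiagonal.mem_antidiagonal.1 hpq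
    obtain ⟨k, hk, hd⟩ := hx (right_ne_zero_of_mul h)
    obtain ⟨α, rfl⟩ := exists_eq_expSum_of_coeff_ne_zero r (left_ne_zero_of_mul h)
    exact ⟨k, hk, add_comm q _ ▸ hd.add_expSum α⟩

theorem toricMon_mem_span_iff {S : Set (Fin n)} {α : Fin n →₀ ℕ} :
    toricMon K a α ∈ Ideal.span (toricGen K a '' S) ↔ ∃ k ∈ S, GenDvd a k (expSum a α) := by
  refine ⟨fun h => exists_genDvd_of_mem_span h (by simp), ?_⟩
  rintro ⟨k, hk, γ, hγ⟩
  have hα : toricMon K a α = toricMon K a γ * toricGen K a k := by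
    rw [← toricMon_single, ← toricMon_add, toricMon_inj, hγ]
    simp [add_comm]
  rw [hα]
  exact Ideal.mul_mem_left _ _ (Ideal.subset_span ⟨k, hk, rfl⟩)

theorem toricMon_mem_colon_iff {i j : Fin n} {α : Fin n →₀ ℕ} :
    toricMon K a α ∈ (Ideal.span {toricGen K a i}).colon {toricGen K a j} ↔
      GenDvd a i (expSum a α + a j) := by
  rw [Submodule.mem_colon_singleton, smul_eq_mul, ← toricMon_single j, ← toricMon_add,
    ← Set.image_singleton, toricMon_mem_span_iff]
  simp

theorem isColonGenerated_of_colon_eq_span (hh : IsHomogeneousFamily a) {i j : Fin n}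
    {S : Set (Fin n)} (hS : (Ideal.span {toricGen K a i}).colon {toricGen K a j} =
      Ideal.span (toricGen K a '' S)) : IsColonGenerated a i j := by
  intro α hα
  rw [← toricMon_mem_colon_iff (K := K), hS, toricMon_mem_span_iff] at hα
  obtain ⟨k, hkS, hk⟩ := hα
  have hkj : toricMon K a (Finsupp.single k 1) ∈
      (Ideal.span {toricGen K a i}).colon {toricGen K a j} := by
    rw [hS, toricMon_single]
    exact Ideal.subset_span ⟨k, hkS, rfl⟩
  obtain ⟨γ, hγ⟩ := toricMon_mem_colon_iff.1 hkj
  have hdeg := hh (α := Finsupp.single k 1 + Finsupp.single j 1) (β := Finsupp.single i 1 + γ)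
    (by simpa using hγ)
  simp only [map_add, Finsupp.degree_single] at hdeg
  obtain ⟨l, rfl⟩ := exists_eq_single_of_degree_eq_one (by omega : γ.degree = 1)
  exact ⟨k, l, hk, by simpa using hγ⟩

theorem isSquarefreeToric_of_midpointFree (hh : IsHomogeneousFamily a)
    (hc : ∀ i j, i ≠ j → IsColonGenerated a i j) (hm : MidpointFree a) :
    IsSquarefreeToric K a := by
  classical
  obtain ⟨e, ⟨E⟩⟩ := Finite.exists_equiv_fin {F : Set (Fin n) // ∃ i, IsMaximalFace a i F}
  let b : Fin n → Fin e →₀ ℕ := fun i =>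
    Finsupp.equivFunOnFinite.symm fun l => Set.indicator (E.symm l).valᶜ 1 i
  have hb : ∀ α l, expSum b α l = faceHeight (E.symm l).1 α := fun α l =>
    Finsupp.apply_linearCombination ℕ (Finsupp.lapply l) b α
  refine ⟨n, e, b, fun i l => Set.indicator_le_self' (by simp) i,
    nonempty_toricRing_algEquiv fun α β => ⟨fun h => ?_, fun h => ?_⟩⟩
  · ext l
    obtain ⟨i, hF⟩ := (E.symm l).2
    rw [hb, hb, faceHeight_congr hh hc hm hF h]
  · refine expSum_eq_of_faceHeight_eq hh hc hm fun i F hF => ?_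
    simpa only [hb, E.symm_apply_apply] using DFunLike.congr_fun h (E ⟨F, i, hF⟩)

theorem toricRing_eq_of_range_subset {p : ℕ} {b : Fin p → Fin d →₀ ℕ}
    (hba : Set.range b ⊆ Set.range a) (hab : ∀ i, ∃ α, a i = expSum b α) :
    toricRing K a = toricRing K b := by
  apply le_antisymm
  · refine Algebra.adjoin_le ?_
    rintro _ ⟨i, rfl⟩
    obtain ⟨α, hα⟩ := hab i
    simpa only [coe_toricMon, ← hα] using! (toricMon K b α).2
  · refine Algebra.adjoin_mono ?_
    rintro _ ⟨l, rfl⟩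
    obtain ⟨i, hi⟩ := hba ⟨l, rfl⟩
    exact ⟨i, congrArg (fun s => monomial s (1 : K)) hi⟩

theorem IsSquarefreeToric.exists_isMinimalFamily (h : IsSquarefreeToric K a) :
    ∃ (p e : ℕ) (b : Fin p → Fin e →₀ ℕ), (∀ i l, b i l ≤ 1) ∧ IsMinimalFamily b ∧
      Nonempty (toricRing K a ≃ₐ[K] toricRing K b) := by
  obtain ⟨_, e, b', hb', ⟨φ⟩⟩ := h
  obtain ⟨p, b, hb, hsub, hexp⟩ := _root_.exists_isMinimalFamily b'
  refine ⟨p, e, b, fun i l => ?_, hb,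
    ⟨φ.trans (Subalgebra.equivOfEq _ _ (toricRing_eq_of_range_subset hsub hexp))⟩⟩
  obtain ⟨i', hi⟩ := hsub ⟨i, rfl⟩
  exact hi ▸ hb' i' l

end ToricRing

/-! ### Initial ideals of toric ideals -/

section InitialIdeal

theorem radical_span_monomial_eq {σ K : Type*} [Field K] (m : MonomialOrder σ)
    {N : Set (σ →₀ ℕ)} (hup : IsUpperSet N) (hN : ∀ (k : ℕ) (α : σ →₀ ℕ), k • α ∈ N → α ∈ N) :
    (Ideal.span ((fun α => monomial α (1 : K)) '' N)).radical =
      Ideal.span ((fun α => monomial α (1 : K)) '' N) := by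
  classical
  have hmem : ∀ f : MvPolynomial σ K,
      f ∈ Ideal.span ((fun α => monomial α (1 : K)) '' N) ↔ ∀ α ∈ f.support, α ∈ N := by
    intro f
    rw [mem_ideal_span_monomial_image]
    exact forall₂_congr fun α _ =>
      ⟨fun ⟨β, hβ, hle⟩ => hup hle hβ, fun hα => ⟨α, hα, le_rfl⟩⟩
  set J := Ideal.span ((fun α => monomial α (1 : K)) '' N)
  refine le_antisymm (fun f hf => ?_) Ideal.le_radical
  -- Split off the terms of `f` in `J`; the leading exponent of the rest `g` cannot lie outside `N`.
  obtain ⟨g, hgf, hg⟩ : ∃ g, f - g ∈ J ∧ ∀ α ∈ g.support, α ∉ N := by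
    refine ⟨∑ α ∈ f.support with α ∉ N, monomial α (coeff α f), (hmem _).2 fun α hα => ?_, ?_⟩
    · by_contra hαN
      refine mem_support_iff.1 hα ?_
      rw [coeff_sub, coeff_sum, Finset.sum_congr rfl fun β _ => coeff_monomial α β _,
        Finset.sum_ite_eq']
      by_cases h : coeff α f = 0 <;> simp [hαN, h]
    · intro α hα
      rw [mem_support_iff, coeff_sum] at hα
      obtain ⟨β, hβ, hα⟩ := Finset.exists_ne_zero_of_sum_ne_zero hα
      obtain rfl := of_not_not fun h : β ≠ α => hα (by rw [coeff_monomial, if_neg h])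
      exact (Finset.mem_filter.1 hβ).2
  have hg0 : g = 0 := by
    by_contra hg0
    have hgJ : g ∈ J.radical := by
      simpa using J.radical.sub_mem hf (Ideal.le_radical hgf)
    obtain ⟨k, hk⟩ := hgJ
    have hdeg := (hmem _).1 hk _ (m.degree_mem_support (pow_ne_zero k hg0))
    rw [m.degree_pow] at hdeg
    exact hg _ (m.degree_mem_support hg0) (hN k _ hdeg)
  rwa [hg0, sub_zero] at hgf

variable {K : Type*} [Field K] {n d : ℕ} {a : Fin n → Fin d →₀ ℕ}

/-- The exponents that are not minimal, with respect to a monomial order, among the exponents `β`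
with the same value `expSum a β`. -/
def nonstandardExps (m : MonomialOrder (Fin n)) (a : Fin n → Fin d →₀ ℕ) : Set (Fin n →₀ ℕ) :=
  {α | ∃ β, expSum a β = expSum a α ∧ m.toSyn β < m.toSyn α}

theorem isUpperSet_nonstandardExps (m : MonomialOrder (Fin n)) :
    IsUpperSet (nonstandardExps m a) := by
  rintro α β hle ⟨δ, hδ, hlt⟩
  obtain ⟨γ, rfl⟩ := exists_add_of_le hle
  refine ⟨δ + γ, by rw [map_add, map_add, hδ], ?_⟩
  rw [map_add, map_add]
  exact add_lt_add_left hlt _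

theorem degree_mem_nonstandardExps (m : MonomialOrder (Fin n)) {f : MvPolynomial (Fin n) K}
    (hf : f ∈ toricIdeal K a) (hf0 : f ≠ 0) : m.degree f ∈ nonstandardExps m a := by
  classical
  by_contra hmin
  have hsum : coeff (expSum a (m.degree f)) (aeval (toricGen K a) f : toricRing K a).1 =
      coeff (m.degree f) f := by
    have hf' : aeval (toricGen K a) f = ∑ α ∈ f.support, coeff α f • toricMon K a α := by
      conv_lhs => rw [f.as_sum]
      simp only [map_sum, toricMon, ← map_smul, smul_eq_mul, mul_one]
    rw [hf', AddSubmonoidClass.coe_finsetSum, coeff_sum,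
      Finset.sum_eq_single_of_mem _ (m.degree_mem_support hf0)]
    · simp
    · intro α hα hne
      have hαf : expSum a α ≠ expSum a (m.degree f) := fun he =>
        hmin ⟨α, he, (m.le_degree hα).lt_of_ne fun h => hne (m.toSyn.injective h)⟩
      simp [coeff_monomial, hαf]
  rw [toricIdeal, RingHom.mem_ker] at hf
  rw [hf, ZeroMemClass.coe_zero, coeff_zero] at hsum
  exact mem_support_iff.1 (m.degree_mem_support hf0) hsum.symm

theorem initialIdeal_toricIdeal (m : MonomialOrder (Fin n)) :
    initialIdeal m (toricIdeal K a) =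
      Ideal.span ((fun α => monomial α (1 : K)) '' nonstandardExps m a) := by
  classical
  apply le_antisymm <;> refine Ideal.span_le.2 ?_
  · rintro _ ⟨f, hf, rfl⟩
    by_cases hf0 : f = 0
    · simp [hf0, MonomialOrder.leadingTerm]
    have hlead : m.leadingTerm f = C (m.leadingCoeff f) * monomial (m.degree f) (1 : K) := by
      rw [MonomialOrder.leadingTerm, C_mul_monomial, mul_one]
    rw [hlead]
    exact Ideal.mul_mem_left _ _
      (Ideal.subset_span ⟨_, degree_mem_nonstandardExps m hf hf0, rfl⟩)
  · rintro _ ⟨α, ⟨β, hβ, hlt⟩, rfl⟩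
    refine Ideal.subset_span ⟨monomial α 1 - monomial β 1,
      monomial_sub_monomial_mem_toricIdeal.2 hβ.symm, ?_⟩
    have hdeg : m.toSyn (m.degree (monomial β (1 : K))) <
        m.toSyn (m.degree (monomial α (1 : K))) := by
      rwa [m.degree_monomial, m.degree_monomial, if_neg one_ne_zero, if_neg one_ne_zero]
    rw [MonomialOrder.leadingTerm, m.leadingCoeff_sub_of_lt hdeg, m.degree_sub_of_lt hdeg,
      m.leadingCoeff_monomial, m.degree_monomial, if_neg one_ne_zero]

theorem revLex_lt_iff (ρ : Equiv.Perm (Fin n)) {α β : Fin n →₀ ℕ} (h : α.degree = β.degree) :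
    (revLex ρ).toSyn β < (revLex ρ).toSyn α ↔
      ∃ i, (∀ j < i, β (ρ j) = α (ρ j)) ∧ α (ρ i) < β (ρ i) := by
  change RevLexSyn.ofExp ρ β < RevLexSyn.ofExp ρ α ↔ _
  rw [RevLexSyn.lt_iff_key, RevLexSyn.key, RevLexSyn.key, Prod.Lex.toLex_lt_toLex]
  simp only [AddEquiv.symm_apply_apply, h, lt_irrefl, true_and, false_or]
  change (∃ i, (∀ j < i, -((β (ρ j) : ℕ) : ℤ) = -((α (ρ j) : ℕ) : ℤ)) ∧
    -((β (ρ i) : ℕ) : ℤ) < -((α (ρ i) : ℕ) : ℤ)) ↔ _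
  simp only [neg_inj, Nat.cast_inj, neg_lt_neg_iff, Nat.cast_lt]

theorem revLex_lt_of_le (ρ : Equiv.Perm (Fin n)) {α β : Fin n →₀ ℕ} (h : α.degree = β.degree)
    {i : Fin n} (hle : ∀ j < i, α (ρ j) ≤ β (ρ j)) (hlt : α (ρ i) < β (ρ i)) :
    (revLex ρ).toSyn β < (revLex ρ).toSyn α := by
  refine lt_of_not_ge fun hc => ?_
  obtain hc | hc := hc.lt_or_eq
  · obtain ⟨k, hk, hkβ⟩ := (revLex_lt_iff ρ h.symm).1 hc
    obtain hki | rfl | hki := lt_trichotomy k i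
    · exact (hle k hki).not_gt hkβ
    · exact hlt.not_gt hkβ
    · exact hlt.ne (hk i hki)
  · exact hlt.ne (by rw [(revLex ρ).toSyn.injective hc])

theorem mem_nonstandardExps_revLex_iff (hh : IsHomogeneousFamily a) (ρ : Equiv.Perm (Fin n))
    {α : Fin n →₀ ℕ} : α ∈ nonstandardExps (revLex ρ) a ↔
      ∃ i, GenDvd a (ρ i) (expSum a (α.filter fun j => ¬ ρ.symm j ≤ i)) := by
  classical
  have hsplit : ∀ i, α.filter (fun j => ρ.symm j ≤ i) + α.filter (fun j => ¬ ρ.symm j ≤ i) = α :=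
    fun i => Finsupp.filter_add_filter_not α _
  constructor
  · rintro ⟨β, hβ, hlt⟩
    obtain ⟨i, heq, hi⟩ := (revLex_lt_iff ρ (hh hβ.symm)).1 hlt
    have hle : α.filter (fun j => ρ.symm j ≤ i) + Finsupp.single (ρ i) 1 ≤ β := by
      intro l
      obtain ⟨j, rfl⟩ := ρ.surjective l
      simp only [Finsupp.add_apply, Finsupp.filter_apply, Equiv.symm_apply_apply,
        Finsupp.single_apply, ρ.injective.eq_iff]
      obtain hj | rfl | hj := lt_trichotomy j i
      · simp [hj.le, hj.ne', heq j hj]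
      · simpa using hi
      · simp [hj.not_ge, hj.ne]
    obtain ⟨δ, rfl⟩ := exists_add_of_le hle
    refine ⟨i, δ, add_left_cancel (a := expSum a (α.filter fun j => ρ.symm j ≤ i)) ?_⟩
    rw [← map_add, hsplit, ← hβ]
    simp [add_assoc]
  · rintro ⟨i, γ, hγ⟩
    let β := α.filter (fun j => ρ.symm j ≤ i) + (Finsupp.single (ρ i) 1 + γ)
    have hβ : expSum a β = expSum a α := by
      conv_rhs => rw [← hsplit i, map_add, hγ]
      simp [β]
    exact ⟨β, hβ, revLex_lt_of_le ρ (hh hβ.symm) (i := i)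
      (fun j hj => by simp [β, hj.le]) (by simp [β])⟩

theorem isCompressedToric_of_midpointFree (hh : IsHomogeneousFamily a)
    (hc : ∀ i j, i ≠ j → IsColonGenerated a i j) (hm : MidpointFree a) :
    IsCompressedToric K a := by
  intro ρ
  rw [initialIdeal_toricIdeal]
  refine radical_span_monomial_eq (revLex ρ) (isUpperSet_nonstandardExps _) fun k α hk => ?_
  rw [mem_nonstandardExps_revLex_iff hh] at hk ⊢
  obtain ⟨i, hi⟩ := hk
  refine ⟨i, genDvd_of_support_subset hh hc hm hi ?_⟩
  intro l hl
  simp only [Finsupp.support_filter, Finset.mem_filter, Finsupp.mem_support_iff,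
    Finsupp.smul_apply, smul_eq_mul] at hl ⊢
  exact ⟨right_ne_zero_of_mul hl.1, hl.2⟩

theorem midpointFree_of_isCompressedToric (ha : Function.Injective a)
    (hh : IsHomogeneousFamily a) (hK : IsCompressedToric K a) : MidpointFree a := by
  intro i j k h
  by_contra hj
  have : NeZero n := ⟨by rintro rfl; exact i.elim0⟩
  -- With `x_j` the smallest variable, `x_i ^ 2` is the leading monomial of `x_i ^ 2 - x_j x_k`.
  let ρ : Equiv.Perm (Fin n) := Equiv.swap 0 j
  have hsq : 2 • Finsupp.single i 1 ∈ nonstandardExps (revLex ρ) a := by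
    refine (mem_nonstandardExps_revLex_iff hh ρ).2 ⟨0, Finsupp.single k 1, ?_⟩
    have hi : ρ.symm i ≠ 0 := by simp [ρ, Equiv.swap_apply_eq_iff, Ne.symm hj]
    rw [Finsupp.filter_eq_self_iff _ _ |>.2 fun l hl => ?_]
    · simp [ρ, h, two_smul]
    · obtain rfl : l = i := by
        by_contra hl'
        simp [Ne.symm hl'] at hl
      exact fun h0 => hi (le_antisymm h0 (Fin.zero_le _))
  have hmem : (X i : MvPolynomial (Fin n) K) ∈ initialIdeal (revLex ρ) (toricIdeal K a) := by
    rw [← hK ρ, initialIdeal_toricIdeal]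
    refine ⟨2, Ideal.subset_span ⟨_, hsq, ?_⟩⟩
    simp [X, monomial_pow]
  rw [initialIdeal_toricIdeal, mem_ideal_span_monomial_image] at hmem
  obtain ⟨α, hα, hle⟩ := hmem (Finsupp.single i 1) (by simp [X])
  obtain ⟨β, hβ, hlt⟩ := isUpperSet_nonstandardExps _ hle hα
  rw [hh.isMinimalFamily ha (by simpa using hβ : expSum a β = a i)] at hlt
  exact lt_irrefl _ hlt

end InitialIdeal

/-! ### First-order jets and graded lifts -/

section Jet

open TrivSqZeroExt

theorem aeval_inr_monomial_eq_zero {σ K V : Type*} [Field K] [AddCommGroup V] [Module K V]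
    [Module Kᵐᵒᵖ V] [IsCentralScalar K V] (v : σ → V) {α : σ →₀ ℕ} (hα : 2 ≤ α.degree) :
    aeval (fun i => (inr (v i) : TrivSqZeroExt K V)) (monomial α (1 : K)) = 0 := by
  obtain ⟨i, β, rfl⟩ := exists_eq_single_add_of_degree_pos (by omega : 0 < α.degree)
  rw [map_add, Finsupp.degree_single] at hα
  obtain ⟨j, γ, rfl⟩ := exists_eq_single_add_of_degree_pos (by omega : 0 < β.degree)
  simp only [monomial_single_add, pow_one, map_mul, aeval_X, ← mul_assoc, inr_mul_inr, zero_mul]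

variable {K : Type*} [Field K] {n d : ℕ} {a : Fin n → Fin d →₀ ℕ}

/-- Reduction modulo the square of the graded maximal ideal of a toric ring with minimal
generators: the constant term, and the coefficients of the generators in the linear part. -/
noncomputable def IsMinimalFamily.jet (K : Type*) [Field K] (ha : IsMinimalFamily a) :
    toricRing K a →ₐ[K] TrivSqZeroExt K (Fin n → K) :=
  toricLift (fun i => inr (Pi.single i 1)) fun α β h => by
    obtain rfl | ⟨hα, hβ⟩ := ha.eq_or_two_le_degree h
    · rfl
    · exact (aeval_inr_monomial_eq_zero _ hα).trans (aeval_inr_monomial_eq_zero _ hβ).symm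

theorem IsMinimalFamily.jet_toricGen (ha : IsMinimalFamily a) (i : Fin n) :
    ha.jet K (toricGen K a i) = inr (Pi.single i 1) :=
  toricLift_toricGen _ _ i

theorem snd_mem_span {V : Type*} [AddCommGroup V] [Module K V] [Module Kᵐᵒᵖ V]
    [IsCentralScalar K V] (θ : toricRing K a →ₐ[K] TrivSqZeroExt K V) (x : toricRing K a) :
    (θ x).snd ∈ Submodule.span K (Set.range fun i => (θ (toricGen K a i)).snd) := by
  induction x using toricRing_induction with
  | algebraMap c =>
    rw [AlgHom.commutes, algebraMap_eq_inl, snd_inl]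
    exact zero_mem _
  | add x y hx hy =>
    rw [map_add, snd_add]
    exact add_mem hx hy
  | mul_toricGen x i hx =>
    rw [map_mul, snd_mul, op_smul_eq_smul]
    exact add_mem (Submodule.smul_mem _ _ (Submodule.subset_span ⟨i, rfl⟩))
      (Submodule.smul_mem _ _ hx)

variable {p e : ℕ} {b : Fin p → Fin e →₀ ℕ}

theorem IsMinimalFamily.span_snd_jet (hb : IsMinimalFamily b)
    (φ : toricRing K a ≃ₐ[K] toricRing K b) :
    Submodule.span K (Set.range fun i => (hb.jet K (φ (toricGen K a i))).snd) = ⊤ := by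
  rw [eq_top_iff, ← (Pi.basisFun K (Fin p)).span_eq, Submodule.span_le]
  rintro _ ⟨s, rfl⟩
  have h := snd_mem_span ((hb.jet K).comp φ.toAlgHom) (φ.symm (toricGen K b s))
  simpa [hb.jet_toricGen] using h

theorem IsMinimalFamily.card_le (hb : IsMinimalFamily b)
    (φ : toricRing K a ≃ₐ[K] toricRing K b) : p ≤ n := by
  have h := finrank_range_le_card (R := K) fun i => (hb.jet K (φ (toricGen K a i))).snd
  rwa [Set.finrank, hb.span_snd_jet φ, finrank_top, Module.finrank_fin_fun, Fintype.card_fin] at h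

theorem IsMinimalFamily.linearIndependent_snd_jet (ha : IsMinimalFamily a)
    (hb : IsMinimalFamily b) (φ : toricRing K a ≃ₐ[K] toricRing K b) :
    LinearIndependent K fun i => (hb.jet K (φ (toricGen K a i))).snd := by
  refine linearIndependent_of_top_le_span_of_card_eq_finrank (hb.span_snd_jet φ).ge ?_
  rw [Fintype.card_fin, Module.finrank_fin_fun]
  exact le_antisymm (ha.card_le φ.symm) (hb.card_le φ)

/-- The linear combination of the monomials with exponents `a i`. -/
noncomputable abbrev linForm (K : Type*) [Field K] {n d : ℕ} (a : Fin n → Fin d →₀ ℕ) :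
    (Fin n → K) →ₗ[K] MvPolynomial (Fin d) K :=
  Fintype.linearCombination K fun i => monomial (a i) 1

theorem linForm_injective (ha : Function.Injective a) : Function.Injective (linForm K a) :=
  ((basisMonomials (Fin d) K).linearIndependent.comp a ha).fintypeLinearCombination_injective

theorem aeval_monomial_one_monomial (a : Fin n → Fin d →₀ ℕ) (α : Fin n →₀ ℕ) :
    aeval (fun i => Polynomial.monomial 1 (monomial (a i) (1 : K))) (monomial α (1 : K)) =
      Polynomial.monomial α.degree (monomial (expSum a α) 1) := by
  induction α using exponent_induction with
  | zero => simp
  | add_single i α ih => simp [monomial_add_single, ih, Polynomial.monomial_mul_monomial]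

/-- The grading of a toric ring with all generators in degree one, as a homomorphism that
multiplies elements of degree `k` by the `k`-th power of a new variable. -/
noncomputable def IsHomogeneousFamily.gradedLift (K : Type*) [Field K]
    (hh : IsHomogeneousFamily a) :
    toricRing K a →ₐ[K] Polynomial (MvPolynomial (Fin d) K) :=
  toricLift (fun i => Polynomial.monomial 1 (monomial (a i) 1)) fun α β h => by
    simp only [aeval_monomial_one_monomial, h, hh h]

theorem IsHomogeneousFamily.gradedLift_toricGen (hh : IsHomogeneousFamily a) (i : Fin n) :
    hh.gradedLift K (toricGen K a i) = Polynomial.monomial 1 (monomial (a i) 1) :=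
  toricLift_toricGen _ _ i

theorem IsHomogeneousFamily.coeff_gradedLift (hh : IsHomogeneousFamily a)
    (ha : IsMinimalFamily a) (x : toricRing K a) :
    (hh.gradedLift K x).coeff 0 = C (ha.jet K x).fst ∧
      (hh.gradedLift K x).coeff 1 = linForm K a (ha.jet K x).snd := by
  induction x using toricRing_induction with
  | algebraMap c =>
    rw [AlgHom.commutes, AlgHom.commutes, algebraMap_eq_inl]
    simp [Polynomial.algebraMap_apply, Polynomial.coeff_C]
  | add x y hx hy => simp [hx, hy]
  | mul_toricGen x i hx =>
    rw [map_mul, map_mul, hh.gradedLift_toricGen, ha.jet_toricGen, Polynomial.mul_coeff_zero,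
      Polynomial.mul_coeff_one]
    simp [hx, smul_monomial, C_mul_monomial, Fintype.linearCombination_apply_single]

end Jet

/-! ### Free generators and translations -/

/-- The generator `a i` occurs in no nontrivial quadratic relation. Under the colon conditions such
a generator can be translated by constants. -/
def IsFreeGen {ι M : Type*} [Add M] (a : ι → M) (i : ι) : Prop :=
  ∀ j k l, a i + a k = a j + a l → j = i ∨ l = i

section FreeGen

variable {ι M : Type*} [AddCommMonoid M] {a : ι → M} {i : ι}

theorem IsFreeGen.mem_support (hi : IsFreeGen a i) (hh : IsHomogeneousFamily a)
    (hc : ∀ j, i ≠ j → IsColonGenerated a i j) {β : ι →₀ ℕ} (h : GenDvd a i (expSum a β)) :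
    i ∈ β.support := by
  induction β using exponent_induction with
  | zero => exact absurd (by simpa using h) (hh.not_genDvd_zero i)
  | add_single j β ih =>
    by_cases hij : i = j
    · simp [hij]
    · obtain ⟨k, l, hk, hkl⟩ := hc j hij (by simpa using h)
      obtain rfl | rfl := hi k l j hkl.symm
      · exact Finsupp.support_mono le_self_add (ih hk)
      · exact absurd rfl hij

theorem IsFreeGen.apply_eq [IsCancelAdd M] (hi : IsFreeGen a i) (hh : IsHomogeneousFamily a)
    (hc : ∀ j, i ≠ j → IsColonGenerated a i j) {α β : ι →₀ ℕ} (h : expSum a α = expSum a β) :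
    α i = β i := by
  have hle : ∀ {α β : ι →₀ ℕ}, expSum a α = expSum a β → β i ≤ α i := by
    intro α β h
    by_contra! hlt
    have hsingle : Finsupp.single i (α i + 1) ≤ β := Finsupp.single_le_iff.2 hlt
    obtain ⟨γ, hγ⟩ := exists_add_of_le hsingle
    have hα : expSum a α = expSum a (.single i (α i)) + expSum a (α.erase i) := by
      rw [← map_add, Finsupp.single_add_erase]
    rw [hα, hγ, Finsupp.single_add, add_assoc, map_add] at h
    have hd : GenDvd a i (expSum a (α.erase i)) := ⟨γ, by simpa using add_left_cancel h⟩
    simpa using hi.mem_support hh hc hd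
  exact (hle h.symm).antisymm (hle h)

end FreeGen

section Translation

variable {K : Type*} [Field K] {n d : ℕ} {a : Fin n → Fin d →₀ ℕ}

theorem factorsThrough_toricGen_add (hh : IsHomogeneousFamily a)
    (hc : ∀ i j, i ≠ j → IsColonGenerated a i j) {c : Fin n → K}
    (hfree : ∀ i, c i ≠ 0 → IsFreeGen a i) :
    Function.FactorsThrough (fun α => aeval
      (fun i => toricGen K a i + algebraMap K (toricRing K a) (c i)) (monomial α (1 : K)))
      (expSum a) := by
  classical
  have hsplit : ∀ γ : Fin n →₀ ℕ, γ.filter (c · = 0) + γ.filter (¬ c · = 0) = γ :=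
    fun γ => Finsupp.filter_add_filter_not γ _
  have hprod : ∀ γ : Fin n →₀ ℕ,
      aeval (fun i => toricGen K a i + algebraMap K (toricRing K a) (c i)) (monomial γ (1 : K)) =
        toricMon K a (γ.filter (c · = 0)) *
          aeval (fun i => toricGen K a i + algebraMap K (toricRing K a) (c i))
            (monomial (γ.filter (¬ c · = 0)) (1 : K)) := by
    intro γ
    conv_lhs => rw [← hsplit γ, ← mul_one (1 : K), ← monomial_mul, map_mul]
    congr 1
    rw [toricMon, aeval_monomial, aeval_monomial]
    congr 1
    refine Finsupp.prod_congr fun i hi => ?_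
    rw [Finsupp.support_filter, Finset.mem_filter] at hi
    rw [hi.2, map_zero, add_zero]
  intro α β h
  have heq : α.filter (¬ c · = 0) = β.filter (¬ c · = 0) := by
    ext i
    rw [Finsupp.filter_apply, Finsupp.filter_apply]
    split_ifs with hi
    · rfl
    · exact (hfree i hi).apply_eq hh (hc i) h
  have hrest : expSum a (α.filter (c · = 0)) = expSum a (β.filter (c · = 0)) := by
    rw [← hsplit α, ← hsplit β, map_add, map_add, ← heq] at h
    exact add_right_cancel h
  beta_reduce
  rw [hprod α, hprod β, heq, toricMon_inj.2 hrest]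

theorem exists_translation (hh : IsHomogeneousFamily a)
    (hc : ∀ i j, i ≠ j → IsColonGenerated a i j) {c : Fin n → K}
    (hfree : ∀ i, c i ≠ 0 → IsFreeGen a i) :
    ∃ τ : toricRing K a ≃ₐ[K] toricRing K a,
      ∀ i, τ (toricGen K a i) = toricGen K a i + algebraMap K _ (c i) := by
  have hneg : ∀ i, (-c) i ≠ 0 → IsFreeGen a i := fun i hi => hfree i (by simpa using hi)
  let σ : toricRing K a →ₐ[K] toricRing K a :=
    toricLift _ (factorsThrough_toricGen_add hh hc hfree)
  let σ' : toricRing K a →ₐ[K] toricRing K a :=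
    toricLift _ (factorsThrough_toricGen_add hh hc hneg)
  have hσ : ∀ i, σ (toricGen K a i) = _ := toricLift_toricGen _ _
  have hσ' : ∀ i, σ' (toricGen K a i) = _ := toricLift_toricGen _ _
  exact ⟨AlgEquiv.ofAlgHom σ σ' (toricRing_algHom_ext fun i => by simp [hσ, hσ'])
    (toricRing_algHom_ext fun i => by simp [hσ, hσ']), hσ⟩

variable {p e : ℕ} {b : Fin p → Fin e →₀ ℕ}

theorem isFreeGen_of_fst_jet_ne_zero (ha : IsMinimalFamily a) (hb : IsMinimalFamily b)
    (φ : toricRing K a ≃ₐ[K] toricRing K b) {i : Fin n}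
    (hi : (hb.jet K (φ (toricGen K a i))).fst ≠ 0) : IsFreeGen a i := by
  intro j k l h
  by_contra! hne
  obtain ⟨hji, hli⟩ := hne
  have hkj : k ≠ j := fun hkj => hli <| by
    rw [hkj, add_comm (a i)] at h
    exact (ha.injective (add_left_cancel h)).symm
  have hkl : k ≠ l := fun hkl => hji <| by
    rw [hkl] at h
    exact (ha.injective (add_right_cancel h)).symm
  let x : Fin n → TrivSqZeroExt K (Fin p → K) := fun i => hb.jet K (φ (toricGen K a i))
  have hx : x i * x k = x j * x l := by
    have hmul : toricGen K a i * toricGen K a k = toricGen K a j * toricGen K a l := by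
      simp only [← toricMon_single, ← toricMon_add]
      exact toricMon_inj.2 (by simpa using h)
    simp only [x, ← map_mul, hmul]
  have hfst : (x i).fst * (x k).fst = (x j).fst * (x l).fst := by
    simpa using congrArg TrivSqZeroExt.fst hx
  have hsnd : (x i).fst • Pi.single k 1 + (x k).fst • Pi.single i 1 =
      (x j).fst • Pi.single l 1 + (x l).fst • (Pi.single j 1 : Fin n → K) := by
    apply (ha.linearIndependent_snd_jet hb φ).fintypeLinearCombination_injective
    simpa [Fintype.linearCombination_apply_single] using congrArg TrivSqZeroExt.snd hx
  by_cases hki : k = i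
  · subst hki
    have hjl : j ≠ l := fun hjl => hji <| by
      rw [hjl, ← two_nsmul, ← two_nsmul] at h
      exact hjl.trans (ha.injective (nsmul_right_injective two_ne_zero h)).symm
    have hj : (x j).fst = 0 := by simpa [hkl.symm, hjl.symm] using (congrFun hsnd l).symm
    rw [hj, zero_mul, mul_self_eq_zero] at hfst
    exact hi hfst
  · exact hi (by simpa [hki, hkl, hkj] using congrFun hsnd k)

theorem exists_algEquiv_fst_jet_eq_zero (hh : IsHomogeneousFamily a)
    (hc : ∀ i j, i ≠ j → IsColonGenerated a i j) (ha : IsMinimalFamily a)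
    (hb : IsMinimalFamily b) (φ : toricRing K a ≃ₐ[K] toricRing K b) :
    ∃ ψ : toricRing K a ≃ₐ[K] toricRing K b, ∀ i, (hb.jet K (ψ (toricGen K a i))).fst = 0 := by
  obtain ⟨τ, hτ⟩ := exists_translation hh hc (c := fun i => -(hb.jet K (φ (toricGen K a i))).fst)
    fun i hi => isFreeGen_of_fst_jet_ne_zero ha hb φ (by simpa using hi)
  exact ⟨τ.trans φ, fun i => by simp [hτ, TrivSqZeroExt.algebraMap_eq_inl]⟩

end Translation

/-! ### Squarefree toric rings have no midpoints -/

theorem associated_of_mul_self_eq_mul {R : Type*} [CommMonoidWithZero R] [IsCancelMulZero R]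
    [DecompositionMonoid R] {f g h : R} (hg : Squarefree g) (hh : Squarefree h) (hg0 : g ≠ 0)
    (hfgh : f * f = g * h) : Associated f g := by
  obtain ⟨w, rfl⟩ : g ∣ f := (hg.dvd_pow_iff_dvd two_ne_zero).1 ⟨h, by rw [sq, hfgh]⟩
  have hw : w * w ∣ h := ⟨g, mul_left_cancel₀ hg0 (by rw [← hfgh]; ac_rfl)⟩
  exact (associated_mul_unit_left g w (hh w hw))

theorem squarefree_of_degreeOf_le_one {σ K : Type*} [Field K] {f : MvPolynomial σ K}
    (hf : f ≠ 0) (h : ∀ l, degreeOf l f ≤ 1) : Squarefree f := by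
  rintro g ⟨w, rfl⟩
  have hw : w ≠ 0 := right_ne_zero_of_mul hf
  have hg : g ≠ 0 := left_ne_zero_of_mul (left_ne_zero_of_mul hf)
  have hdeg : ∀ l, degreeOf l g = 0 := by
    intro l
    have := h l
    rw [degreeOf_mul_eq (mul_ne_zero hg hg) hw, degreeOf_mul_eq hg hg] at this
    omega
  have htotal : g.totalDegree = 0 := by
    rw [totalDegree_eq_zero_iff]
    exact fun m hm l => Nat.le_zero.1 ((monomial_le_degreeOf l hm).trans (hdeg l).le)
  rw [totalDegree_eq_zero_iff_eq_C] at htotal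
  rw [htotal] at hg ⊢
  exact (isUnit_iff_ne_zero.2 (by simpa using hg)).map C

theorem coeff_two_mul {R : Type*} [Semiring R] {f g : Polynomial R} (hf : f.coeff 0 = 0)
    (hg : g.coeff 0 = 0) : (f * g).coeff 2 = f.coeff 1 * g.coeff 1 := by
  simp [Polynomial.coeff_mul, Finset.Nat.antidiagonal_succ, hf, hg]

theorem natTrailingDegree_eq_one {R : Type*} [Semiring R] {f : Polynomial R}
    (h0 : f.coeff 0 = 0) (h1 : f.coeff 1 ≠ 0) : f.natTrailingDegree = 1 := by
  refine (Polynomial.natTrailingDegree_le_of_ne_zero h1).antisymm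
    (Polynomial.le_natTrailingDegree (by rintro rfl; simp at h1) fun m hm => ?_)
  rwa [Nat.lt_one_iff.1 hm]

section Squarefree

variable {K : Type*} [Field K] {n d p e : ℕ} {a : Fin n → Fin d →₀ ℕ} {b : Fin p → Fin e →₀ ℕ}

theorem squarefree_linForm (hb : Function.Injective b) (hb1 : ∀ i l, b i l ≤ 1)
    {v : Fin p → K} (hv : v ≠ 0) : Squarefree (linForm K b v) := by
  refine squarefree_of_degreeOf_le_one ((map_ne_zero_iff _ (linForm_injective hb)).2 hv)
    fun l => ?_
  rw [Fintype.linearCombination_apply]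
  refine (degreeOf_sum_le l _ _).trans (Finset.sup_le fun i _ => ?_)
  rw [smul_monomial]
  refine degreeOf_le_iff.2 fun m hm => ?_
  rw [Finset.mem_singleton.1 (support_monomial_subset hm)]
  exact hb1 i l

theorem fst_jet_symm_toricGen (ha : IsMinimalFamily a) (hb : IsMinimalFamily b)
    {φ : toricRing K a ≃ₐ[K] toricRing K b}
    (hφ : ∀ i, (hb.jet K (φ (toricGen K a i))).fst = 0) (s : Fin p) :
    (ha.jet K (φ.symm (toricGen K b s))).fst = 0 := by
  have h : ((TrivSqZeroExt.fstHom K K (Fin p → K)).comp (hb.jet K)).comp φ.toAlgHom =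
      (TrivSqZeroExt.fstHom K K (Fin n → K)).comp (ha.jet K) :=
    toricRing_algHom_ext fun i => by simp [hφ, ha.jet_toricGen]
  simpa [hb.jet_toricGen] using (DFunLike.congr_fun h (φ.symm (toricGen K b s))).symm

theorem isHomogeneousFamily_of_algEquiv (ha : IsMinimalFamily a) (hh : IsHomogeneousFamily a)
    (hb : IsMinimalFamily b) {φ : toricRing K b ≃ₐ[K] toricRing K a}
    (hφ : ∀ s, (ha.jet K (φ (toricGen K b s))).fst = 0) : IsHomogeneousFamily b := by
  let F : toricRing K b →ₐ[K] Polynomial (MvPolynomial (Fin d) K) :=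
    (hh.gradedLift K).comp φ.toAlgHom
  have hgen : ∀ s, F (toricGen K b s) ≠ 0 ∧ (F (toricGen K b s)).natTrailingDegree = 1 := by
    intro s
    obtain ⟨h0, h1⟩ := hh.coeff_gradedLift ha (φ (toricGen K b s))
    have h1' : (F (toricGen K b s)).coeff 1 ≠ 0 := by
      refine ne_of_eq_of_ne h1 ((map_ne_zero_iff _ (linForm_injective ha.injective)).2 ?_)
      exact (hb.linearIndependent_snd_jet ha φ).ne_zero s
    refine ⟨fun h => h1' (by rw [h, Polynomial.coeff_zero]), natTrailingDegree_eq_one ?_ h1'⟩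
    exact h0.trans (by rw [hφ, C_0])
  have hmon : ∀ α, F (toricMon K b α) ≠ 0 ∧
      (F (toricMon K b α)).natTrailingDegree = α.degree := by
    intro α
    induction α using exponent_induction with
    | zero => simp [toricMon]
    | add_single s α ih =>
      obtain ⟨hs, hs1⟩ := hgen s
      rw [toricMon_add, toricMon_single, map_mul]
      refine ⟨mul_ne_zero ih.1 hs, ?_⟩
      rw [Polynomial.natTrailingDegree_mul ih.1 hs, ih.2, hs1, map_add, Finsupp.degree_single]
  intro α β h
  rw [← (hmon α).2, ← (hmon β).2, toricMon_inj.2 h]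

theorem midpointFree_of_algEquiv (ha : IsMinimalFamily a) (hb : IsMinimalFamily b)
    (hhb : IsHomogeneousFamily b) (hb1 : ∀ s l, b s l ≤ 1) {φ : toricRing K a ≃ₐ[K] toricRing K b}
    (hφ : ∀ i, (hb.jet K (φ (toricGen K a i))).fst = 0) : MidpointFree a := by
  intro i j k h
  let v : Fin n → Fin p → K := fun i => (hb.jet K (φ (toricGen K a i))).snd
  have hv : LinearIndependent K v := ha.linearIndependent_snd_jet hb φ
  have hcoeff : ∀ i j, (hhb.gradedLift K (φ (toricGen K a i * toricGen K a j))).coeff 2 =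
      linForm K b (v i) * linForm K b (v j) := by
    intro i j
    have h0 : ∀ i, (hhb.gradedLift K (φ (toricGen K a i))).coeff 0 = 0 := fun i => by
      rw [(hhb.coeff_gradedLift hb _).1, hφ, C_0]
    rw [map_mul, map_mul, coeff_two_mul (h0 i) (h0 j), (hhb.coeff_gradedLift hb _).2,
      (hhb.coeff_gradedLift hb _).2]
  have hgen : toricGen K a i * toricGen K a i = toricGen K a j * toricGen K a k := by
    simp only [← toricMon_single, ← toricMon_add]
    exact toricMon_inj.2 (by simpa using h)
  have hmul : linForm K b (v i) * linForm K b (v i) = linForm K b (v j) * linForm K b (v k) := by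
    rw [← hcoeff, ← hcoeff, hgen]
  have hsq : ∀ i, Squarefree (linForm K b (v i)) := fun i =>
    squarefree_linForm hb.injective hb1 (hv.ne_zero i)
  obtain ⟨u, hu⟩ := associated_of_mul_self_eq_mul (hsq j) (hsq k) (hsq j).ne_zero hmul
  obtain ⟨c, -, hcu⟩ := isUnit_iff_eq_C_of_isReduced.1 u.isUnit
  have hvij : c • v i = (1 : K) • v j := by
    apply linForm_injective hb.injective
    rw [map_smul, one_smul, ← hu, hcu, mul_comm, C_mul']
  exact hv.eq_of_smul_apply_eq_smul_apply 1 c j i one_ne_zero hvij.symm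

theorem midpointFree_of_isSquarefreeToric (ha : Function.Injective a)
    (hh : IsHomogeneousFamily a) (hc : ∀ i j, i ≠ j → IsColonGenerated a i j)
    (h : IsSquarefreeToric K a) : MidpointFree a := by
  obtain ⟨p, e, b, hb1, hb, ⟨φ⟩⟩ := h.exists_isMinimalFamily
  have ha' : IsMinimalFamily a := hh.isMinimalFamily ha
  obtain ⟨ψ, hψ⟩ := exists_algEquiv_fst_jet_eq_zero hh hc ha' hb φ
  exact midpointFree_of_algEquiv ha' hb
    (isHomogeneousFamily_of_algEquiv ha' hh hb (fst_jet_symm_toricGen ha' hb hψ)) hb1 hψ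

end Squarefree

section Main

variable {K : Type*} [Field K] {n d : ℕ} {a : Fin n → Fin d →₀ ℕ}

theorem IsStronglyKoszulWrt.colon_singleton {R : Type*} [CommRing R] {𝔪 : Ideal R}
    {u : Fin n → R} (h : IsStronglyKoszulWrt 𝔪 u) {i j : Fin n} (hij : i < j) :
    ∃ S : Set (Fin n), (Ideal.span {u i}).colon {u j} = Ideal.span (u '' S) := by
  have hmono : StrictMono ![i, j] := Fin.strictMono_iff_lt_succ.2 (by simpa using hij)
  have himage : (fun k => u (![i, j] k)) '' {k | k < 1} = {u i} := by
    rw [show {k : Fin 2 | k < 1} = {0} by ext k; fin_cases k <;> simp, Set.image_singleton]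
    rfl
  exact himage ▸ h.colon 2 ![i, j] hmono 1

theorem theorem2p1_general (ha : Function.Injective a) (hh : IsHomogeneousFamily a)
    (hK : ∀ i j, i < j → ∃ S : Set (Fin n),
      (Ideal.span {toricGen K a i}).colon {toricGen K a j} = Ideal.span (toricGen K a '' S)) :
    List.TFAE
      [IsSquarefreeToric K a,
       ¬ ∃ i j k : Fin n, (X i ^ 2 - X j * X k : MvPolynomial (Fin n) K) ≠ 0 ∧
          (X i ^ 2 - X j * X k : MvPolynomial (Fin n) K) ∈ toricIdeal K a,
       IsCompressedToric K a] ∧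
    (IsSquarefreeToric K a → IsCompressedToric K a) := by
  have hlt : ∀ i j, i < j → IsColonGenerated a i j := fun i j hij =>
    (hK i j hij).elim fun _ hS => isColonGenerated_of_colon_eq_span hh hS
  have hc : ∀ i j, i ≠ j → IsColonGenerated a i j := fun i j hij =>
    hij.lt_or_gt.elim (hlt i j) fun hji => (hlt j i hji).symm
  rw [not_exists_sq_sub_mul_mem_toricIdeal_iff ha]
  have h12 : IsSquarefreeToric K a → MidpointFree a := midpointFree_of_isSquarefreeToric ha hh hc
  have h23 : MidpointFree a → IsCompressedToric K a := isCompressedToric_of_midpointFree hh hc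
  refine ⟨?_, fun h => h23 (h12 h)⟩
  tfae_have 1 → 2 := h12
  tfae_have 2 → 1 := isSquarefreeToric_of_midpointFree hh hc
  tfae_have 2 → 3 := h23
  tfae_have 3 → 2 := midpointFree_of_isCompressedToric ha hh
  tfae_finish

end Main

theorem theorem2p1 {K : Type*} [Field K] {n d : ℕ} (a : Fin n → Fin d →₀ ℕ)
    (ha : Function.Injective a) (D : ℕ) (hD : 0 < D) (hdeg : ∀ i, (a i).degree = D)
    (hK : IsStronglyKoszulToric K a) :
    List.TFAE
      [IsSquarefreeToric K a,
       ¬ ∃ i j k : Fin n, (X i ^ 2 - X j * X k : MvPolynomial (Fin n) K) ≠ 0 ∧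
          (X i ^ 2 - X j * X k : MvPolynomial (Fin n) K) ∈ toricIdeal K a,
       IsCompressedToric K a] ∧
    (IsSquarefreeToric K a → IsCompressedToric K a) :=
  theorem2p1_general ha (isHomogeneousFamily_of_map_eq Finsupp.degree hD hdeg)
    fun _ _ hij => hK.colon_singleton hij
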